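/- Homomorphisms of von Neumann algebras are unital $*$-homomorphisms. For $\alpha,\beta:A\to B$ let $\mathrm{Hom}(\alpha,\beta)=\{t\in B: t\,\alpha(a)=\beta(a)\,t\ \ \forall a\in A\}$; the composition $\circ$ of intertwiners is the product in $B$, $1_\alpha$ denotes the unit of $B$ as an element of $\mathrm{Hom}(\alpha,\alpha)$, and for $s\in\mathrm{Hom}(\alpha,\alpha')$ one puts $s\times t=s\,\alpha(t)$. A solution of the conjugacy relations for $\alpha:A\to B$ and $\bar\alpha:B\to A$ is a pair $w\in\mathrm{Hom}(\mathrm{id}_A,\bar\alpha\alpha)$, $\bar w\in\mathrm{Hom}(\mathrm{id}_B,\alpha\bar\alpha)$ with $(w^*\times1_{\bar\alpha})\circ(1_{\bar\alpha}\times\bar w)=1_{\bar\alpha}$ and $(1_\alpha\times w^*)\circ(\bar w\times 1_\alpha)=1_\alpha$. The homomorphism $\alpha$ has finite dimension if, for some $\bar\alpha$, there is such a solution with $w^*w=d\cdot 1$ and $\bar w^*\bar w=d\cdot 1$ for one and the same real $d$; $\dim(\alpha)$ is the infimum of these $d$ over all $\bar\alpha$ and all such solutions, and a solution with $d=\dim(\alpha)$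 is called standard. $\mathrm{End}_0(N)$ denotes the endomorphisms of $N$ of finite dimension. Let $N$ be an infinite factor (a factor containing a non-unitary isometry; this includes all type III factors) acting on a separable Hilbert space. A Q-system $\mathbf A=(\theta,w,x)$ in $\mathrm{End}_0(N)$ consists of $\theta\in\mathrm{End}_0(N)$, $w\in\mathrm{Hom}(\mathrm{id}_N,\theta)$ and $x\in\mathrm{Hom}(\theta,\theta^2)$ with $$(w^*\times1_\theta)\circ x=(1_\theta\times w^*)\circ x=1_\theta,\qquad (x\times1_\theta)\circ x=(1_\theta\times x)\circ x,$$ $$(1_\theta\times x^*)\circ(x\times1_\theta)=xx^*=(x^*\times1_\theta)\circ(1_\theta\times x),\qquad w^*w=\sqrt{\dim\theta}\cdot1,\quad x^*x=\sqrt{\dim\theta}\cdot1 .$$ The associated extension is a von Neumann algebra $M$ with homomorphisms $\iota:N\to M$, $\bar\iota:M\to N$ and an element $v\in M$ such that $\theta=\bar\iota\iota$, $(w,v)$ is a standard solution of the conjugacy relations for $\iota,\bar\iota$, and $x=\bar\iota(v)$. $\mathbf A$ is called simple if $M$ is a factor. A standard module of $\mathbf A$ is a pair $(\beta,m)$ with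 $\beta\in\mathrm{End}_0(N)$ and $m\in\mathrm{Hom}(\beta,\theta\beta)$ such that $(w^*\times1_\beta)\circ m=1_\beta$, $(1_\theta\times m)\circ m=(x\times1_\beta)\circ m$, and $m^*m$ is a scalar multiple of $1_\beta$. Modules $(\beta,m)$ and $(\beta',m')$ are unitarily equivalent if there is a unitary $u\in\mathrm{Hom}(\beta,\beta')$ with $m'\circ u=(1_\theta\times u)\circ m$. **Proposition.** Let $\mathbf A=(\theta,w,x)$ be a simple Q-system in $\mathrm{End}_0(N)$ with associated extension $(M,\iota,\bar\iota,v)$. For every standard module $(\beta,m)$ of $\mathbf A$ there is a homomorphism $\varphi:N\to M$ of finite dimension such that $(\bar\iota\varphi,\ 1_{\bar\iota}\times v\times 1_\varphi)$ is a standard module of $\mathbf A$ and $(\beta,m)$ is unitarily equivalent to it. -/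

import Mathlib

noncomputable section

namespace VonNeumannAlgebra

variable {H : Type*} [NormedAddCommGroup H] [InnerProductSpace ℂ H] [CompleteSpace H]

/-- The elements of a von Neumann algebra `N`, as a unital `*`-algebra over `ℂ`. -/
abbrev Elt (N : VonNeumannAlgebra H) : Type _ := ↥N.toStarSubalgebra

/-- `N` is a factor: its centre is `ℂ · 1`. -/
def IsFactor (N : VonNeumannAlgebra H) : Prop :=
  Subalgebra.center ℂ N.Elt = ⊥

/-- `N` is infinite: the projection `1` is Murray-von Neumann equivalent in `N` to a proper
subprojection `s s*` of itself, i.e. `N` contains a non-unitary isometry. -/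
def IsInfinite (N : VonNeumannAlgebra H) : Prop :=
  ∃ s : N.Elt, star s * s = 1 ∧ s * star s ≠ 1

end VonNeumannAlgebra

namespace QSys

/-! ### The 2-category of unital `*`-homomorphisms and their intertwiners -/

section TwoCategory

variable {A B C : Type*}
  [Ring A] [StarRing A] [Algebra ℂ A]
  [Ring B] [StarRing B] [Algebra ℂ B]
  [Ring C] [StarRing C] [Algebra ℂ C]

/-- `t ∈ Hom(α, β)` for homomorphisms `α, β : A → B`. The concatenation `s ∘ t` of intertwiners
is the product `s * t` in `B`, and `1_α` is the element `1`. -/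
def IsIntertwiner (α β : A →⋆ₐ[ℂ] B) (t : B) : Prop :=
  ∀ a : A, t * α a = β a * t

/-- The monoidal product `s × t = s · α(t) ∈ Hom(α γ, α' γ')` of intertwiners
`s ∈ Hom(α, α')`, where `α, α' : B → C`, and `t ∈ Hom(γ, γ')`, where `γ, γ' : A → B`.
It depends, besides `s` and `t`, on the source `α` of `s`. -/
def hprod (α : B →⋆ₐ[ℂ] C) (s : C) (t : B) : C :=
  s * α t

/-- `(w, w')` is a solution of the conjugacy relations for `α : A → B` and `α' : B → A`. -/
structure IsConjugateSolution (α : A →⋆ₐ[ℂ] B) (α' : B →⋆ₐ[ℂ] A) (w : A) (w' : B) : Prop where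
  /-- `w ∈ Hom(id_A, α' α)` -/
  left_mem : IsIntertwiner (StarAlgHom.id ℂ A) (α'.comp α) w
  /-- `w' ∈ Hom(id_B, α α')` -/
  right_mem : IsIntertwiner (StarAlgHom.id ℂ B) (α.comp α') w'
  /-- `(w* × 1_α') ∘ (1_α' × w') = 1_α'` -/
  left_rel : hprod (α'.comp α) (star w) 1 * hprod α' 1 w' = 1
  /-- `(1_α × w*) ∘ (w' × 1_α) = 1_α` -/
  right_rel : hprod α 1 (star w) * hprod (StarAlgHom.id ℂ B) w' 1 = 1

/-- `(w, w')` is a solution of the conjugacy relations with `w* w = d · 1` and `w'* w' = d · 1`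
(the same real number `d`). -/
structure IsNormalizedSolution (α : A →⋆ₐ[ℂ] B) (α' : B →⋆ₐ[ℂ] A) (w : A) (w' : B) (d : ℝ) : Prop
    extends IsConjugateSolution α α' w w' where
  left_norm : star w * w = algebraMap ℂ A d
  right_norm : star w' * w' = algebraMap ℂ B d

/-- `α` has finite dimension: it has a conjugate, with a normalized solution of the conjugacy
relations. -/
def HasFiniteDim (α : A →⋆ₐ[ℂ] B) : Prop :=
  ∃ (α' : B →⋆ₐ[ℂ] A) (w : A) (w' : B) (d : ℝ), IsNormalizedSolution α α' w w' d

/-- The dimension of a homomorphism of finite dimension: the infimum of the numbers `d` over all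
normalized solutions of the conjugacy relations. -/
def dim (α : A →⋆ₐ[ℂ] B) : ℝ :=
  sInf {d : ℝ | ∃ (α' : B →⋆ₐ[ℂ] A) (w : A) (w' : B), IsNormalizedSolution α α' w w' d}

/-- `(w, w')` is a standard solution of the conjugacy relations: it is normalized and attains the
infimum that defines the dimension. -/
def IsStandardSolution (α : A →⋆ₐ[ℂ] B) (α' : B →⋆ₐ[ℂ] A) (w : A) (w' : B) : Prop :=
  IsNormalizedSolution α α' w w' (dim α)

end TwoCategory

/-! ### Q-systems, their modules and their extensions -/

section QSystems

variable (A : Type*) [Ring A] [StarRing A] [Algebra ℂ A]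

/-- A Q-system `(θ, w, x)` in `End₀(A)`: a standard C* Frobenius algebra in the tensor category of
endomorphisms of `A` of finite dimension. -/
structure QSystem where
  θ : A →⋆ₐ[ℂ] A
  w : A
  x : A
  finiteDim : HasFiniteDim θ
  /-- `w ∈ Hom(id, θ)` -/
  w_mem : IsIntertwiner (StarAlgHom.id ℂ A) θ w
  /-- `x ∈ Hom(θ, θ²)` -/
  x_mem : IsIntertwiner θ (θ.comp θ) x
  /-- `(w* × 1_θ) ∘ x = 1_θ` -/
  unit_left : hprod θ (star w) 1 * x = 1
  /-- `(1_θ × w*) ∘ x = 1_θ` -/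
  unit_right : hprod θ 1 (star w) * x = 1
  /-- `(x × 1_θ) ∘ x = (1_θ × x) ∘ x` -/
  assoc : hprod θ x 1 * x = hprod θ 1 x * x
  /-- `(1_θ × x*) ∘ (x × 1_θ) = x x*` -/
  frobenius_left : hprod θ 1 (star x) * hprod θ x 1 = x * star x
  /-- `(x* × 1_θ) ∘ (1_θ × x) = x x*` -/
  frobenius_right : hprod (θ.comp θ) (star x) 1 * hprod θ 1 x = x * star x
  /-- `w* w = √(dim θ) · 1` -/
  standard_w : star w * w = algebraMap ℂ A (Real.sqrt (dim θ) : ℝ)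
  /-- `x* x = √(dim θ) · 1_θ` -/
  standard_x : star x * x = algebraMap ℂ A (Real.sqrt (dim θ) : ℝ)

variable {A}

/-- `(β, m)` is a standard module of the Q-system `Q`. -/
structure IsStandardModule (Q : QSystem A) (β : A →⋆ₐ[ℂ] A) (m : A) : Prop where
  /-- `β` is an object of `End₀(A)` -/
  finiteDim : HasFiniteDim β
  /-- `m ∈ Hom(β, θ β)` -/
  mem : IsIntertwiner β (Q.θ.comp β) m
  /-- `(w* × 1_β) ∘ m = 1_β` -/
  unit : hprod Q.θ (star Q.w) 1 * m = 1
  /-- `(1_θ × m) ∘ m = (x × 1_β) ∘ m` -/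
  repr : hprod Q.θ 1 m * m = hprod Q.θ Q.x 1 * m
  /-- `m* m` is a multiple of `1_β` -/
  standard : ∃ c : ℂ, star m * m = algebraMap ℂ A c

/-- The modules `(β, m)` and `(β', m')` of `Q` are unitarily equivalent: there is a unitary
`u ∈ Hom(β, β')` with `m' ∘ u = (1_θ × u) ∘ m`. -/
def UnitarilyEquivalent (Q : QSystem A) (β : A →⋆ₐ[ℂ] A) (m : A) (β' : A →⋆ₐ[ℂ] A) (m' : A) :
    Prop :=
  ∃ u ∈ unitary A, IsIntertwiner β β' u ∧ m' * u = hprod Q.θ 1 u * m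

/-- The data `(ι, ι', v)`, with `ι : A → B` and `ι' : B → A`, that make `B` the extension of `A`
associated with the Q-system `(θ, w, x)`: `θ = ι' ι`, `(w, v)` is a standard solution of the
conjugacy relations for `ι` and `ι'`, and `x = ι'(v)`. These data are unique up to isomorphism,
since `b = ι(w* ι'(b)) v` for all `b ∈ B`. -/
structure Extension (Q : QSystem A) (B : Type*) [Ring B] [StarRing B] [Algebra ℂ B] where
  ι : A →⋆ₐ[ℂ] B
  ι' : B →⋆ₐ[ℂ] A
  v : B
  θ_eq : Q.θ = ι'.comp ι
  standard : IsStandardSolution ι ι' Q.w v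
  x_eq : Q.x = ι' v

end QSystems

end QSys

end

/-! Write `d = √(dim θ)`. A module `(β, m)` is a direct summand of the free module `(θβ, x)` via
`m`, and the summand is cut out by a projection on the side of `M`. The element `e = ι(m*) v` lies
in `Hom(ιβ, ιβ)`, and the module law and associativity give `e² = d e`. If `d⁻¹ e = s s*` for an
isometry `s ∈ M`, then `φ = s* ιβ(·) s` is the corresponding subobject of `ιβ`, and `u = d^(-1/2)
ι'(s*) m` is the unitary equivalence, because `m m* = ι'(e)` and `m* m = d`.

Two points need work. Self-adjointness of `e`: the idempotent `p = d⁻¹ e` is a contraction, since `e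
e* = ι(m*) v v* ι(m) ≤ d ι(m* m) = d²`, and a contractive idempotent is a projection
(`star_eq_of_contractive_idempotent`, `star_moduleElement`). The Frobenius relation then yields `m
m* = ι'(e)` (`mul_star_self`).

Existence of `s` and finite dimension of `φ`: for a projection `q ≠ 0` in `Hom(α, α)` and a
conjugate solution `(w, w')`, the element `w'* q w'` is central, so `q w'` is a multiple of an
isometry with range below `q`. A Schröder-Bernstein argument enlarges that range to `q`
(`exists_isometry_of_dominates`). The conjugate subobject is cut out of `α'` by the range projection
of the dual idempotent of `q` (`hasFiniteDim_compress`). -/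

namespace VonNeumannAlgebra

/-! ### Projections and isometries in a von Neumann algebra. -/

section Hilbert

variable {H : Type*} [NormedAddCommGroup H] [InnerProductSpace ℂ H] [CompleteSpace H]

/-- The orthogonal projection onto an invariant subspace of `x` and `star x` commutes with `x`. -/
theorem commute_starProjection {V : Submodule ℂ H} [V.HasOrthogonalProjection] {x : H →L[ℂ] H}
    (hx : V ≤ V.comap (x : H →ₗ[ℂ] H)) (hx' : V ≤ V.comap ((star x : H →L[ℂ] H) : H →ₗ[ℂ] H)) :
    Commute V.starProjection x := by
  have key : ∀ y : H →L[ℂ] H, V ≤ V.comap (y : H →ₗ[ℂ] H) →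
      V.starProjection * y * V.starProjection = y * V.starProjection := by
    intro y hy
    ext h
    exact Submodule.starProjection_eq_self_iff.2 (hy (V.starProjection_apply_mem h))
  have hs : star V.starProjection = V.starProjection :=
    (isStarProjection_starProjection (U := V)).isSelfAdjoint.star_eq
  have h1 := key x hx
  have h2 := congrArg star (key _ hx')
  simp only [star_mul, star_star, hs, ← mul_assoc] at h2
  exact h2.symm.trans h1

/-- The orthogonal projection onto a closed subspace that is invariant under the commutant of `N`
belongs to `N`. -/
theorem starProjection_mem {N : VonNeumannAlgebra H} {V : Submodule ℂ H}
    [V.HasOrthogonalProjection]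
    (hV : ∀ y ∈ N.commutant, V ≤ V.comap (y : H →ₗ[ℂ] H)) : V.starProjection ∈ N := by
  rw [← N.commutant_commutant, mem_commutant_iff]
  intro y hy
  exact (commute_starProjection (hV y hy) (hV _ (star_mem hy))).symm

end Hilbert

variable {H : Type*} [NormedAddCommGroup H] [InnerProductSpace ℂ H] [CompleteSpace H]
variable {N : VonNeumannAlgebra H}

theorem commute_of_mem_commutant {y : H →L[ℂ] H} (hy : y ∈ N.commutant) (a : N.Elt) :
    Commute y (a : H →L[ℂ] H) :=
  (mem_commutant_iff.1 hy _ a.2).symm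

theorem norm_sq_apply (a : N.Elt) (h : H) :
    inner ℂ ((star a * a : N.Elt).1 h) h = ((‖a.1 h‖ ^ 2 : ℝ) : ℂ) := by
  change inner ℂ ((star a.1 * a.1) h) h = _
  rw [ContinuousLinearMap.star_eq_adjoint, mul_apply_eq_comp,
    ContinuousLinearMap.adjoint_inner_left, inner_self_eq_norm_sq_to_K]
  simp

/-- A sum of positive elements `a* a` vanishes only if each summand does. -/
theorem eq_zero_of_sum_eq_zero {a b c : N.Elt}
    (h : star a * a + star b * b + star c * c = 0) : a = 0 := by
  apply Subtype.ext
  ext k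
  have h1 : inner ℂ ((star a * a + star b * b + star c * c : N.Elt).1 k) k = (0 : ℂ) := by
    rw [h]; simp
  have h2 : inner ℂ ((star a * a + star b * b + star c * c : N.Elt).1 k) k
      = inner ℂ ((star a * a : N.Elt).1 k) k + inner ℂ ((star b * b : N.Elt).1 k) k
        + inner ℂ ((star c * c : N.Elt).1 k) k := by
    rw [← inner_add_left, ← inner_add_left]; rfl
  rw [h2, norm_sq_apply, norm_sq_apply, norm_sq_apply] at h1
  norm_cast at h1
  have : ‖a.1 k‖ ^ 2 = 0 := by
    nlinarith [sq_nonneg ‖a.1 k‖, sq_nonneg ‖b.1 k‖, sq_nonneg ‖c.1 k‖]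
  simpa using this

theorem eq_zero_of_star_mul_self {a : N.Elt} (h : star a * a = 0) : a = 0 :=
  eq_zero_of_sum_eq_zero (b := 0) (c := 0) (by simpa using h)

/-- A scalar of the form `a* a` is a nonnegative real number. -/
theorem exists_real_of_star_mul_self [Nontrivial N.Elt] {a : N.Elt} {c : ℂ}
    (h : star a * a = algebraMap ℂ N.Elt c) : ∃ r : ℝ, 0 ≤ r ∧ c = r := by
  have hH : Nontrivial H := by
    by_contra hH
    rw [not_nontrivial_iff_subsingleton] at hH
    exact one_ne_zero (α := N.Elt) (Subtype.ext (ContinuousLinearMap.ext fun _ =>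
      Subsingleton.elim _ _))
  obtain ⟨k, hk⟩ := exists_ne (0 : H)
  have h1 := norm_sq_apply a k
  rw [h] at h1
  have h2 : inner ℂ ((algebraMap ℂ N.Elt c).1 k) k
      = (starRingEnd ℂ) c * ((‖k‖ ^ 2 : ℝ) : ℂ) := by
    rw [show (algebraMap ℂ N.Elt c).1 k = c • k from rfl, inner_smul_left,
      inner_self_eq_norm_sq_to_K]
    simp
  rw [h2] at h1
  have hk' : ((‖k‖ ^ 2 : ℝ) : ℂ) ≠ 0 := by
    norm_cast; exact pow_ne_zero _ (norm_ne_zero_iff.2 hk)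
  refine ⟨‖a.1 k‖ ^ 2 / ‖k‖ ^ 2, by positivity, ?_⟩
  have h3 : (starRingEnd ℂ) c = ((‖a.1 k‖ ^ 2 / ‖k‖ ^ 2 : ℝ) : ℂ) := by
    rw [Complex.ofReal_div, ← h1, mul_div_assoc, div_self hk', mul_one]
  rw [← Complex.conj_conj c, h3, Complex.conj_ofReal]

/-- An idempotent `p` such that `1 - p p*` is of the form `y* y` is a projection. -/
theorem star_eq_of_contractive_idempotent {p y : N.Elt} (hp : p * p = p)
    (hy : 1 - p * star p = star y * y) : star p = p := by
  have hp' : star p * star p = star p := by rw [← star_mul, hp]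
  -- With `T = p p*`, the three summands equal `T² - T`, `(1 - T) T (1 - T)` and `T (1 - T) T`, and
  -- these add up to zero.
  have h : star (star p - p * star p) * (star p - p * star p)
      + star (star p * (1 - p * star p) - 0) * (star p * (1 - p * star p) - 0)
      + star (y * (p * star p)) * (y * (p * star p)) = 0 := by
    have e1 : star (y * (p * star p)) * (y * (p * star p))
        = (p * star p) * (1 - p * star p) * (p * star p) := by
      rw [hy]; simp [mul_assoc]
    rw [e1]
    simp only [star_sub, star_mul, star_star, star_one, sub_zero]
    have r1 : ∀ z, p * (p * z) = p * z := fun z => by rw [← mul_assoc, hp]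
    have r2 : ∀ z, star p * (star p * z) = star p * z := fun z => by rw [← mul_assoc, hp']
    simp only [mul_sub, sub_mul, mul_assoc, hp', r1, mul_one, one_mul]
    abel
  have h0 := sub_eq_zero.1 (eq_zero_of_sum_eq_zero h)
  calc star p = p * star p := h0
    _ = star (p * star p) := by simp
    _ = p := by rw [← h0, star_star]

/-- The range projection of an idempotent of `N`. It commutes with every element that commutes,
along with its adjoint, with the idempotent. -/
theorem exists_range_projection {p : N.Elt} (hp : p * p = p) :
    ∃ f : N.Elt, star f = f ∧ f * p = p ∧ p * f = f ∧
      ∀ x : N.Elt, x * p = p * x → star x * p = p * star x → f * x = x * f := by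
  have hp1 : p.1 * p.1 = p.1 := congrArg Subtype.val hp
  have hid : IsIdempotentElem p.1 := hp1
  set V : Submodule ℂ H := p.1.range with hV
  have hc : IsClosed (V : Set H) := ContinuousLinearMap.IsIdempotentElem.isClosed_range hid
  have : CompleteSpace V := hc.completeSpace_coe
  have inv : ∀ x : H →L[ℂ] H, x * p.1 = p.1 * x → V ≤ V.comap (x : H →ₗ[ℂ] H) := by
    rintro x hx _ ⟨h, rfl⟩
    exact ⟨x h, (DFunLike.congr_fun hx h).symm⟩
  have hmem : V.starProjection ∈ N := starProjection_mem fun y hy =>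
    inv y (commute_of_mem_commutant hy p)
  refine ⟨⟨_, hmem⟩, Subtype.ext ?_, Subtype.ext ?_, Subtype.ext ?_, fun x h1 h2 =>
    Subtype.ext ?_⟩
  · exact (isStarProjection_starProjection (U := V)).isSelfAdjoint.star_eq
  · ext h
    exact Submodule.starProjection_eq_self_iff.2 ⟨h, rfl⟩
  · ext h
    obtain ⟨k, hk⟩ := V.starProjection_apply_mem h
    change p.1 (V.starProjection h) = V.starProjection h
    rw [← hk]
    exact DFunLike.congr_fun hp1 k
  · exact commute_starProjection (inv _ (congrArg Subtype.val h1))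
      (inv _ (congrArg Subtype.val h2))

/-- Schröder-Bernstein for projections: a projection that dominates the range of an isometry of `N`
is itself the range projection of an isometry of `N`. -/
theorem exists_isometry_of_dominates {q t : N.Elt} (hq : q * q = q) (hq' : star q = q)
    (ht : star t * t = 1) (hqt : q * t = t) :
    ∃ s : N.Elt, star s * s = 1 ∧ s * star s = q := by
  -- The defect `1 - q` is shifted along the powers of `t`, as in Hilbert's hotel. The isometry
  -- sought acts as `t` on `V` and as the identity on its complement.
  set V₀ : Submodule ℂ H := ⨆ k : ℕ, (t ^ k * (1 - q) : N.Elt).1.range with hV₀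
  set V := V₀.topologicalClosure with hV
  have hle : ∀ k h, (t ^ k * (1 - q) : N.Elt).1 h ∈ V := fun k h =>
    V₀.le_topologicalClosure (Submodule.mem_iSup_of_mem k ⟨h, rfl⟩)
  have inv : ∀ y : H →L[ℂ] H, (∀ k h, y ((t ^ k * (1 - q) : N.Elt).1 h) ∈ V) →
      V ≤ V.comap (y : H →ₗ[ℂ] H) := by
    intro y hy
    refine V₀.topologicalClosure_minimal ?_
      (V₀.isClosed_topologicalClosure.preimage y.continuous)
    refine iSup_le fun k => ?_
    rintro _ ⟨h, rfl⟩
    exact hy k h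
  have : CompleteSpace V := V₀.isClosed_topologicalClosure.completeSpace_coe
  have hmem : V.starProjection ∈ N := starProjection_mem fun y hy => inv y fun k h => by
    have := DFunLike.congr_fun (commute_of_mem_commutant hy (t ^ k * (1 - q))).eq h
    rw [show y ((t ^ k * (1 - q) : N.Elt).1 h) = (t ^ k * (1 - q) : N.Elt).1 (y h) from this]
    exact hle k _
  set e : N.Elt := ⟨V.starProjection, hmem⟩ with he
  have hproj := isStarProjection_starProjection (U := V)
  have he2 : e * e = e := Subtype.ext hproj.isIdempotentElem
  have he' : star e = e := Subtype.ext hproj.isSelfAdjoint.star_eq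
  have heq : e * (1 - q) = 1 - q := by
    apply Subtype.ext
    ext h
    refine Submodule.starProjection_eq_self_iff.2 ?_
    simpa using hle 0 h
  have het : e * t * e = t * e := by
    apply Subtype.ext
    ext h
    refine Submodule.starProjection_eq_self_iff.2 ?_
    refine inv t.1 (fun k h => ?_) (V.starProjection_apply_mem h)
    have := hle (k + 1) h
    rw [pow_succ', mul_assoc] at this
    exact this
  have htq : star t * q = star t := by
    have := congrArg star hqt
    rwa [star_mul, hq'] at this
  -- Checked on the generators `t ^ k (1 - q)`. For `k = 0` only `1 - q` contributes, as `t* (1 - q)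
  -- = 0`; for `k + 1`, `t*` goes one step back and `t` returns.
  have hfix : (t * e * star t + (1 - q)) * e = e := by
    have key : V ≤ LinearMap.ker (((t * e * star t + (1 - q)) - 1 : N.Elt).1 : H →ₗ[ℂ] H) := by
      refine V₀.topologicalClosure_minimal ?_
        (ContinuousLinearMap.isClosed_ker ((t * e * star t + (1 - q)) - 1 : N.Elt).1)
      refine iSup_le fun k => ?_
      rintro _ ⟨h, rfl⟩
      have h0 : ((t * e * star t + (1 - q)) - 1) * (t ^ k * (1 - q)) = 0 := by
        have ht1 : ∀ z, star t * (t * z) = z := fun z => by rw [← mul_assoc, ht, one_mul]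
        have hqt1 : ∀ z, q * (t * z) = t * z := fun z => by rw [← mul_assoc, hqt]
        cases k with
        | zero =>
          simp only [pow_zero, one_mul, sub_mul, add_mul, mul_sub, mul_one, mul_assoc, htq, hq]
          abel
        | succ k =>
          have hek : e * (t ^ k * (1 - q)) = t ^ k * (1 - q) := by
            apply Subtype.ext
            ext h
            exact Submodule.starProjection_eq_self_iff.2 (hle k h)
          simp only [pow_succ', mul_assoc, sub_mul, add_mul, one_mul, ht1, hqt1, hek]
          abel
      exact DFunLike.congr_fun (congrArg Subtype.val h0) h
    have : ((t * e * star t + (1 - q)) - 1) * e = 0 := by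
      apply Subtype.ext
      ext h
      exact key (V.starProjection_apply_mem h)
    rw [sub_mul, one_mul] at this
    exact sub_eq_zero.1 this
  -- The right side is self-adjoint, is the identity on `V` and has range in `V`.
  have hfix' : e = t * e * star t + (1 - q) := by
    have h1 := congrArg star hfix
    simp only [star_mul, star_add, star_sub, star_one, star_star, he', hq'] at h1
    have h2 : e * (t * (e * star t)) = t * (e * star t) := by
      simp only [← mul_assoc, het]
    rw [mul_add, heq, h2] at h1
    rw [mul_assoc, h1]
  have hte : e * star t * e = e * star t := by
    have := congrArg star het
    simpa [star_mul, he', mul_assoc] using this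
  refine ⟨t * e + (1 - e), ?_, ?_⟩
  · have ht1 : ∀ z, star t * (t * z) = z := fun z => by rw [← mul_assoc, ht, one_mul]
    rw [mul_assoc] at het hte
    simp only [star_add, star_mul, star_sub, star_one, he', add_mul, mul_add, sub_mul, mul_sub,
      mul_one, one_mul, mul_assoc, ht1, he2, het, hte]
    abel
  · have he3 : ∀ z, e * (e * z) = e * z := fun z => by rw [← mul_assoc, he2]
    simp only [star_add, star_mul, star_sub, star_one, he', add_mul, mul_add, sub_mul, mul_sub,
      mul_one, one_mul, mul_assoc, he2, he3]
    rw [mul_assoc] at hfix'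
    have : t * (e * star t) = e - (1 - q) := by rw [eq_sub_iff_add_eq, ← hfix']
    rw [this]
    abel

/-- The central elements of a factor are scalars. -/
theorem IsFactor.exists_scalar (hN : N.IsFactor) {a : N.Elt} (ha : ∀ b, a * b = b * a) :
    ∃ c : ℂ, a = algebraMap ℂ N.Elt c := by
  have : a ∈ Subalgebra.center ℂ N.Elt := Subalgebra.mem_center_iff.2 fun b => (ha b).symm
  rw [hN, Algebra.mem_bot] at this
  obtain ⟨c, hc⟩ := this
  exact ⟨c, hc.symm⟩

end VonNeumannAlgebra

noncomputable section

namespace QSys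

/-! ### Conjugate solutions, subobjects and dual idempotents. -/

section Conjugates

variable {A B C : Type*}
  [Ring A] [StarRing A] [Algebra ℂ A]
  [Ring B] [StarRing B] [Algebra ℂ B]
  [Ring C] [StarRing C] [Algebra ℂ C]

theorem isConjugateSolution_iff {α : A →⋆ₐ[ℂ] B} {α' : B →⋆ₐ[ℂ] A} {w : A} {w' : B} :
    IsConjugateSolution α α' w w' ↔
      (∀ a, w * a = α' (α a) * w) ∧ (∀ b, w' * b = α (α' b) * w') ∧
        star w * α' w' = 1 ∧ α (star w) * w' = 1 := by
  constructor
  · rintro ⟨h1, h2, h3, h4⟩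
    simp only [hprod, map_one, mul_one, one_mul] at h3 h4
    exact ⟨h1, h2, h3, h4⟩
  · rintro ⟨h1, h2, h3, h4⟩
    refine ⟨h1, h2, ?_, ?_⟩
    · simpa only [hprod, map_one, mul_one, one_mul] using h3
    · simpa only [hprod, map_one, mul_one, one_mul] using h4

namespace IsConjugateSolution

variable {α : A →⋆ₐ[ℂ] B} {α' : B →⋆ₐ[ℂ] A} {w : A} {w' : B}

theorem left_mul (h : IsConjugateSolution α α' w w') (a : A) : w * a = α' (α a) * w :=
  (isConjugateSolution_iff.1 h).1 a

theorem right_mul (h : IsConjugateSolution α α' w w') (b : B) : w' * b = α (α' b) * w' :=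
  (isConjugateSolution_iff.1 h).2.1 b

theorem star_left_mul_map (h : IsConjugateSolution α α' w w') : star w * α' w' = 1 :=
  (isConjugateSolution_iff.1 h).2.2.1

theorem map_star_left_mul (h : IsConjugateSolution α α' w w') : α (star w) * w' = 1 :=
  (isConjugateSolution_iff.1 h).2.2.2

theorem symm (h : IsConjugateSolution α α' w w') : IsConjugateSolution α' α w' w := by
  refine isConjugateSolution_iff.2 ⟨h.right_mul, h.left_mul, ?_, ?_⟩
  · simpa [map_star] using congrArg star h.map_star_left_mul
  · simpa [map_star] using congrArg star h.star_left_mul_map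

theorem mul_star_left (h : IsConjugateSolution α α' w w') (a : A) :
    a * star w = star w * α' (α a) := by
  simpa [map_star] using congrArg star (h.left_mul (star a))

theorem comp {γ : B →⋆ₐ[ℂ] C} {γ' : C →⋆ₐ[ℂ] B} {r : B} {r' : C}
    (hγ : IsConjugateSolution γ γ' r r') (h : IsConjugateSolution α α' w w') :
    IsConjugateSolution (γ.comp α) (α'.comp γ') (α' r * w) (γ w' * r') := by
  refine isConjugateSolution_iff.2 ⟨fun a => ?_, fun c => ?_, ?_, ?_⟩
  · simp only [StarAlgHom.comp_apply]
    rw [mul_assoc, h.left_mul, ← mul_assoc, ← map_mul, hγ.left_mul, map_mul, mul_assoc]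
  · simp only [StarAlgHom.comp_apply]
    rw [mul_assoc, hγ.right_mul, ← mul_assoc, ← map_mul, h.right_mul, map_mul, mul_assoc]
  · simp only [StarAlgHom.comp_apply, star_mul]
    rw [← map_star, mul_assoc, ← map_mul, map_mul γ', ← mul_assoc (star r), ← hγ.mul_star_left,
      mul_assoc, hγ.star_left_mul_map, mul_one, h.star_left_mul_map]
  · simp only [StarAlgHom.comp_apply, star_mul]
    rw [← map_star, ← mul_assoc, ← map_mul, map_mul α, mul_assoc (α (star w)), ← h.right_mul,
      ← mul_assoc, h.map_star_left_mul, one_mul, hγ.map_star_left_mul]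

/-- The element `w* w` is central. -/
theorem star_left_mul_left_comm (h : IsConjugateSolution α α' w w') (a : A) :
    star w * w * a = a * (star w * w) := by
  rw [mul_assoc, h.left_mul, ← mul_assoc, ← h.mul_star_left, mul_assoc]

end IsConjugateSolution

/-- The homomorphism `a ↦ t* α(a) t` defined by an isometry `t` whose range projection commutes
with the image of `α`. -/
def compress (α : A →⋆ₐ[ℂ] B) (t : B) (ht : star t * t = 1)
    (hα : ∀ a, t * star t * α a = α a * (t * star t)) : A →⋆ₐ[ℂ] B where
  toFun a := star t * α a * t
  map_one' := by simp [ht]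
  map_mul' a b := by
    have : star t * α a * t * (star t * α b * t) = star t * (α a * (t * star t)) * α b * t := by
      simp only [mul_assoc]
    rw [this, ← hα]
    simp only [← mul_assoc, ht, one_mul, map_mul]
  map_zero' := by simp
  map_add' a b := by simp [mul_add, add_mul]
  commutes' c := by
    simp only [AlgHomClass.commutes]
    rw [← Algebra.commutes, mul_assoc, ht, mul_one]
  map_star' a := by simp [map_star, mul_assoc]

section compress

variable {α : A →⋆ₐ[ℂ] B} {t : B} {ht : star t * t = 1}
  {hα : ∀ a, t * star t * α a = α a * (t * star t)}

theorem compress_apply (a : A) : compress α t ht hα a = star t * α a * t := rfl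

theorem compress_mul_star (a : A) : compress α t ht hα a * star t = star t * α a := by
  rw [compress_apply, mul_assoc, mul_assoc, ← hα, ← mul_assoc, ← mul_assoc, ht, one_mul]

end compress

/-- The dual idempotent `α'(w'* q) w ∈ Hom(α', α')` of `q ∈ Hom(α, α)`. -/
def dualIdempotent (α' : B →⋆ₐ[ℂ] A) (w : A) (w' q : B) : A := α' (star w' * q) * w

section dualIdempotent

variable {α : A →⋆ₐ[ℂ] B} {α' : B →⋆ₐ[ℂ] A} {w : A} {w' q : B}

theorem dualIdempotent_mul_left (h : IsConjugateSolution α α' w w')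
    (hq : ∀ a, q * α a = α a * q) : dualIdempotent α' w w' q * w = α' q * w := by
  rw [dualIdempotent, mul_assoc, h.left_mul, ← mul_assoc, ← map_mul, mul_assoc, hq, ← mul_assoc,
    h.symm.star_left_mul_map, one_mul]

/-- Bending `q` around `w'` and straightening by a conjugacy relation gives `q` back. -/
theorem star_right_mul_map_dualIdempotent (h : IsConjugateSolution α α' w w') : star w' * α (dualIdempotent α' w w' q) = star w' * q := by
  rw [dualIdempotent, map_mul, ← mul_assoc, ← h.symm.mul_star_left, mul_assoc,
    h.symm.star_left_mul_map, mul_one]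

/-- Duality reverses products, so idempotence survives. Self-adjointness need not, since `(w, w')`
is not assumed standard; for this reason a range projection of the dual idempotent is used later. -/
theorem dualIdempotent_mul_self (h : IsConjugateSolution α α' w w')
    (hq : ∀ a, q * α a = α a * q) (hqq : q * q = q) :
    dualIdempotent α' w w' q * dualIdempotent α' w w' q = dualIdempotent α' w w' q := by
  nth_rw 1 [dualIdempotent]
  rw [mul_assoc, h.left_mul, ← mul_assoc, ← map_mul, mul_assoc, hq, ← mul_assoc,
    star_right_mul_map_dualIdempotent h, mul_assoc, hqq]
  rfl

theorem map_mul_dualIdempotent (h : IsConjugateSolution α α' w w')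
    (hq : ∀ a, q * α a = α a * q) (b : B) :
    α' b * dualIdempotent α' w w' q = dualIdempotent α' w w' q * α' b := by
  calc α' b * (α' (star w' * q) * w)
      = α' (b * star w' * q) * w := by simp only [map_mul, mul_assoc]
    _ = α' (star w' * (α (α' b) * q)) * w := by rw [h.symm.mul_star_left, mul_assoc]
    _ = α' (star w' * q) * (α' (α (α' b)) * w) := by
      rw [← hq]; simp only [map_mul, mul_assoc]
    _ = α' (star w' * q) * w * α' b := by rw [← h.left_mul, mul_assoc]

/-- If the dual vanishes, so does `w'* q`, and then `q = w'* α(w) q = w'* q α(w) = 0`. -/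
theorem dualIdempotent_ne_zero (h : IsConjugateSolution α α' w w')
    (hq : ∀ a, q * α a = α a * q) (hq0 : q ≠ 0) : dualIdempotent α' w w' q ≠ 0 := by
  intro h0
  apply hq0
  have h1 := star_right_mul_map_dualIdempotent (q := q) h
  rw [h0, map_zero, mul_zero] at h1
  have h2 : star w' * α w * q = 0 := by rw [mul_assoc, ← hq, ← mul_assoc, ← h1, zero_mul]
  rwa [h.symm.star_left_mul_map, one_mul] at h2

end dualIdempotent

/-- A conjugate of the subobject of `α` defined by an isometry `t` is the subobject of `α'` defined
by an isometry `t'` onto the range of the dual idempotent. -/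
theorem IsConjugateSolution.compress {α : A →⋆ₐ[ℂ] B} {α' : B →⋆ₐ[ℂ] A} {w : A} {w' : B}
    (h : IsConjugateSolution α α' w w')
    {t : B} (ht : star t * t = 1) (hα : ∀ a, t * star t * α a = α a * (t * star t))
    {t' : A} (ht' : star t' * t' = 1) (hα' : ∀ b, t' * star t' * α' b = α' b * (t' * star t'))
    (hl : t' * star t' * dualIdempotent α' w w' (t * star t)
      = dualIdempotent α' w w' (t * star t))
    (hr : dualIdempotent α' w w' (t * star t) * (t' * star t') = t' * star t') :
    IsConjugateSolution (QSys.compress α t ht hα) (QSys.compress α' t' ht' hα')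
      (star t' * α' (star t) * w) (star t * α (star t') * w') := by
  set q := t * star t with hq
  set f := t' * star t' with hf
  set P := dualIdempotent α' w w' q with hP
  have hqt : q * t = t := by rw [hq, mul_assoc, ht, mul_one]
  have htq : star t * q = star t := by rw [hq, ← mul_assoc, ht, one_mul]
  have hft : f * t' = t' := by rw [hf, mul_assoc, ht', mul_one]
  have htf : star t' * f = star t' := by rw [hf, ← mul_assoc, ht', one_mul]
  have hPt : P * t' = t' := by rw [← hft, ← mul_assoc, hr]
  have hPw : P * w = α' q * w := dualIdempotent_mul_left h hα
  have hwP : star w' * α P = star w' * q := star_right_mul_map_dualIdempotent h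
  -- Since `P w = α'(q) w`, the vector `α'(t*) w` lies in the range of `P`, so inserting `f = t'
  -- t'*` changes nothing.
  have hfw : f * (α' (star t) * w) = α' (star t) * w := by
    have e : α' (star t) * w = P * (α' (star t) * w) := by
      rw [← mul_assoc, ← map_mul_dualIdempotent h hα, mul_assoc, ← hP, hPw, ← mul_assoc,
        ← map_mul, htq]
    rw [e, ← mul_assoc, hl]
  have hqw : star w' * q * α f = star w' * α f := by
    rw [← hwP, mul_assoc, ← map_mul, hr]
  have key1 : QSys.compress α' t' ht' hα' (star (star t * α (star t') * w'))
      * (star t' * α' (star t) * w) = 1 := by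
    simp only [star_mul, star_star, ← map_star, compress_apply]
    calc star t' * α' (star w' * (α t' * t)) * t' * (star t' * α' (star t) * w)
        = star t' * α' (star w' * (α t' * t)) * (f * (α' (star t) * w)) := by
          simp only [hf, mul_assoc]
      _ = star t' * α' (star w' * (α t' * (t * star t))) * w := by
          rw [hfw]; simp only [map_mul, mul_assoc]
      _ = star t' * (α' (star w' * q) * (α' (α t') * w)) := by
          rw [← hq, ← hα]; simp only [map_mul, mul_assoc]
      _ = star t' * (P * t') := by rw [← h.left_mul, hP, dualIdempotent, mul_assoc (α' _)]
      _ = 1 := by rw [hPt, ht']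
  have key2 : star (star t * α (star t') * w')
      * QSys.compress α t ht hα (star t' * α' (star t) * w) = 1 := by
    simp only [star_mul, star_star, ← map_star, compress_apply]
    calc star w' * (α t' * t) * (star t * α (star t' * α' (star t) * w) * t)
        = star w' * (α t' * q * α (star t' * (α' (star t) * w))) * t := by
          simp only [hq, mul_assoc]
      _ = star w' * q * α (f * (α' (star t) * w)) * t := by
          rw [← hα]; simp only [hf, map_mul, mul_assoc]
      _ = star w' * α (α' (star t) * w) * t := by
          rw [map_mul, ← mul_assoc, hqw, mul_assoc (star w'), ← map_mul, hfw]
      _ = star t * (star w' * α w) * t := by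
          rw [map_mul, ← mul_assoc, ← h.symm.mul_star_left]; simp only [mul_assoc]
      _ = 1 := by rw [h.symm.star_left_mul_map, mul_one, ht]
  refine isConjugateSolution_iff.2 ⟨fun a => ?_, fun b => ?_, ?_, ?_⟩
  · symm
    simp only [compress_apply]
    calc star t' * α' (star t * α a * t) * t' * (star t' * α' (star t) * w)
        = star t' * α' (star t * α a * t) * (f * (α' (star t) * w)) := by
          simp only [hf, map_mul, mul_assoc]
      _ = star t' * α' (star t * (α a * (t * star t))) * w := by
          rw [hfw]; simp only [map_mul, mul_assoc]
      _ = star t' * α' (star t * (t * star t) * α a) * w := by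
          rw [← hα]; simp only [hq, mul_assoc]
      _ = star t' * α' (star t) * (α' (α a) * w) := by
          rw [← hq, htq]; simp only [map_mul, mul_assoc]
      _ = star t' * α' (star t) * w * a := by rw [← h.left_mul]; simp only [mul_assoc]
  · have hfw' : q * (α (star t') * w') = α (star t') * w' := by
      have := congrArg star hqw
      simp only [star_mul, ← map_star, star_star] at this
      have hqs : star q = q := by simp [hq]
      have hfs : star f = f := by simp [hf]
      rw [hqs, hfs] at this
      have e : α (star t') * (α f * w') = α (star t') * w' := by
        rw [← mul_assoc, ← map_mul, htf]
      calc q * (α (star t') * w') = α (star t') * (q * w') := by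
            rw [← mul_assoc, hα, mul_assoc]
        _ = α (star t') * (α f * (q * w')) := by
            rw [← mul_assoc (α (star t')) (α f), ← map_mul, htf]
        _ = α (star t') * w' := by rw [this, e]
    symm
    simp only [compress_apply]
    calc star t * α (star t' * α' b * t') * t * (star t * α (star t') * w')
        = star t * α (star t' * α' b * t') * (q * (α (star t') * w')) := by
          simp only [hq, map_mul, mul_assoc]
      _ = star t * α (star t' * (α' b * (t' * star t'))) * w' := by
          rw [hfw']; simp only [map_mul, mul_assoc]
      _ = star t * α (star t' * (t' * star t') * α' b) * w' := by
          rw [← hα']; simp only [hf, mul_assoc]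
      _ = star t * α (star t') * (α (α' b) * w') := by
          rw [← hf, htf]; simp only [map_mul, mul_assoc]
      _ = star t * α (star t') * w' * b := by rw [← h.right_mul]; simp only [mul_assoc]
  · have := congrArg star key1
    rwa [star_mul, ← map_star, star_star, star_one] at this
  · have := congrArg star key2
    rwa [star_mul, ← map_star, star_star, star_one] at this

end Conjugates

/-! ### Finite dimension and subobjects over factors. -/

section Factors

variable {H : Type*} [NormedAddCommGroup H] [InnerProductSpace ℂ H] [CompleteSpace H]
  {K : Type*} [NormedAddCommGroup K] [InnerProductSpace ℂ K] [CompleteSpace K]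
  {N : VonNeumannAlgebra H} {M : VonNeumannAlgebra K}

theorem star_algebraMap_real (r : ℝ) :
    star (algebraMap ℂ N.Elt (r : ℂ)) = algebraMap ℂ N.Elt (r : ℂ) := by
  rw [← algebraMap_star_comm]; simp

/-- For a factor, the element `w* w` of a conjugate solution is a positive scalar. -/
theorem IsConjugateSolution.exists_pos_scalar [Nontrivial N.Elt] (hN : N.IsFactor)
    {α : N.Elt →⋆ₐ[ℂ] M.Elt} {α' : M.Elt →⋆ₐ[ℂ] N.Elt} {w : N.Elt} {w' : M.Elt}
    (h : IsConjugateSolution α α' w w') :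
    ∃ r : ℝ, 0 < r ∧ star w * w = algebraMap ℂ N.Elt (r : ℂ) := by
  obtain ⟨c, hc⟩ := hN.exists_scalar h.star_left_mul_left_comm
  obtain ⟨r, hr, rfl⟩ := VonNeumannAlgebra.exists_real_of_star_mul_self hc
  refine ⟨r, lt_of_le_of_ne hr ?_, hc⟩
  rintro rfl
  have hw : w = 0 := VonNeumannAlgebra.eq_zero_of_star_mul_self (by rw [hc]; simp)
  have := h.star_left_mul_map
  rw [hw, star_zero, zero_mul] at this
  exact zero_ne_one this

/-- Between factors, every homomorphism with a conjugate has finite dimension. -/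
theorem IsConjugateSolution.hasFiniteDim [Nontrivial N.Elt] [Nontrivial M.Elt]
    (hN : N.IsFactor) (hM : M.IsFactor)
    {α : N.Elt →⋆ₐ[ℂ] M.Elt} {α' : M.Elt →⋆ₐ[ℂ] N.Elt} {w : N.Elt} {w' : M.Elt}
    (h : IsConjugateSolution α α' w w') : HasFiniteDim α := by
  obtain ⟨r, hr, hw⟩ := h.exists_pos_scalar hN
  obtain ⟨s, hs, hw'⟩ := h.symm.exists_pos_scalar hM
  -- Scaling `w` by `a` and `w'` by `a⁻¹` keeps the conjugacy relations and turns `r, s` into `a² r,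
  -- a⁻² s`. These agree exactly when `a⁴ = s / r`.
  set a : ℝ := √(√(s / r)) with ha
  have ha0 : 0 < a := by positivity
  have ha2 : a * a = √(s / r) := Real.mul_self_sqrt (by positivity)
  have ha4 : (a * a) * (a * a) = s / r := by rw [ha2]; exact Real.mul_self_sqrt (by positivity)
  have hinv : (algebraMap ℂ N.Elt (a : ℂ)) * algebraMap ℂ N.Elt ((a⁻¹ : ℝ) : ℂ) = 1 := by
    rw [← map_mul, ← Complex.ofReal_mul, mul_inv_cancel₀ ha0.ne']; simp
  have hinv' : (algebraMap ℂ M.Elt (a : ℂ)) * algebraMap ℂ M.Elt ((a⁻¹ : ℝ) : ℂ) = 1 := by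
    rw [← map_mul, ← Complex.ofReal_mul, mul_inv_cancel₀ ha0.ne']; simp
  refine ⟨α', algebraMap ℂ N.Elt (a : ℂ) * w, algebraMap ℂ M.Elt ((a⁻¹ : ℝ) : ℂ) * w',
    (a * a) * r, ⟨isConjugateSolution_iff.2 ⟨fun b => ?_, fun b => ?_, ?_, ?_⟩, ?_, ?_⟩⟩
  · rw [mul_assoc, h.left_mul, Algebra.left_comm]
  · rw [mul_assoc, h.right_mul, Algebra.left_comm]
  · rw [star_mul, star_algebraMap_real, map_mul, AlgHomClass.commutes, mul_assoc,
      ← mul_assoc (algebraMap ℂ N.Elt _), hinv, one_mul, h.star_left_mul_map]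
  · rw [star_mul, star_algebraMap_real, map_mul, AlgHomClass.commutes, mul_assoc,
      ← mul_assoc (algebraMap ℂ M.Elt _), hinv', one_mul, h.map_star_left_mul]
  · rw [star_mul, star_algebraMap_real, mul_assoc, Algebra.left_comm,
      Algebra.left_comm, hw, ← map_mul, ← map_mul]
    congr 1; push_cast; ring
  · rw [star_mul, star_algebraMap_real, mul_assoc, Algebra.left_comm,
      Algebra.left_comm, hw', ← map_mul, ← map_mul, ← Complex.ofReal_mul, ← Complex.ofReal_mul]
    congr 2
    have : s = (a * a) * (a * a) * r := by rw [ha4]; field_simp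
    rw [this]; field_simp

/-- Every nonzero projection of `Hom(α, α)` is the range projection of an isometry, if `α` is a
homomorphism into a factor that has a conjugate. -/
theorem IsConjugateSolution.exists_isometry (hM : M.IsFactor)
    {α : N.Elt →⋆ₐ[ℂ] M.Elt} {α' : M.Elt →⋆ₐ[ℂ] N.Elt} {w : N.Elt} {w' : M.Elt}
    (h : IsConjugateSolution α α' w w') {q : M.Elt} (hqq : q * q = q) (hqs : star q = q)
    (hq : ∀ a, q * α a = α a * q) (hq0 : q ≠ 0) :
    ∃ t : M.Elt, star t * t = 1 ∧ t * star t = q := by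
  have : Nontrivial M.Elt := ⟨⟨q, 0, hq0⟩⟩
  -- `q w'` is again in `Hom(id, α α')`, so its square lies in `Hom(id, id)`, the centre.
  have hcomm : ∀ b, star (q * w') * (q * w') * b = b * (star (q * w') * (q * w')) := by
    intro b
    have e : star (q * w') * (q * w') = star w' * q * w' := by
      rw [star_mul, hqs, mul_assoc, ← mul_assoc q, hqq, mul_assoc]
    rw [e, mul_assoc, h.right_mul, mul_assoc, ← mul_assoc q, hq]
    simp only [← mul_assoc]
    rw [h.symm.mul_star_left]
  obtain ⟨c, hc⟩ := hM.exists_scalar hcomm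
  obtain ⟨r, hr, rfl⟩ := VonNeumannAlgebra.exists_real_of_star_mul_self hc
  have hr0 : r ≠ 0 := by
    rintro rfl
    have h0 : q * w' = 0 := VonNeumannAlgebra.eq_zero_of_star_mul_self (by rw [hc]; simp)
    apply hq0
    rw [← mul_one q, ← h.map_star_left_mul, ← mul_assoc, hq, mul_assoc, h0, mul_zero]
  have hr1 : (√r)⁻¹ * ((√r)⁻¹ * r) = 1 := by
    have := Real.mul_self_sqrt hr
    have h2 : √r ≠ 0 := Real.sqrt_ne_zero'.2 (lt_of_le_of_ne hr hr0.symm)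
    field_simp; nlinarith
  refine VonNeumannAlgebra.exists_isometry_of_dominates
    (t := algebraMap ℂ M.Elt (((√r)⁻¹ : ℝ) : ℂ) * (q * w')) hqq hqs ?_ ?_
  · rw [star_mul, star_algebraMap_real, mul_assoc, Algebra.left_comm,
      Algebra.left_comm, hc, ← map_mul, ← map_mul, ← Complex.ofReal_mul, ← Complex.ofReal_mul, hr1]
    simp
  · rw [Algebra.left_comm, ← mul_assoc q, hqq]

/-- Subobjects of homomorphisms with a conjugate, between factors, have finite dimension. -/
theorem IsConjugateSolution.hasFiniteDim_compress [Nontrivial N.Elt] [Nontrivial M.Elt]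
    (hN : N.IsFactor) (hM : M.IsFactor)
    {α : N.Elt →⋆ₐ[ℂ] M.Elt} {α' : M.Elt →⋆ₐ[ℂ] N.Elt} {w : N.Elt} {w' : M.Elt}
    (h : IsConjugateSolution α α' w w')
    {t : M.Elt} (ht : star t * t = 1) (hα : ∀ a, t * star t * α a = α a * (t * star t)) :
    HasFiniteDim (QSys.compress α t ht hα) := by
  have hqq : t * star t * (t * star t) = t * star t := by
    rw [mul_assoc, ← mul_assoc (star t), ht, one_mul]
  have hq0 : t * star t ≠ 0 := by
    intro h0
    have : star t * (t * star t) * t = 1 := by simp only [← mul_assoc, ht, one_mul]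
    rw [h0] at this
    simp at this
  obtain ⟨f, hf, hfP, hPf, hcomm⟩ := VonNeumannAlgebra.exists_range_projection
    (dualIdempotent_mul_self h hα hqq)
  have hff : f * f = f := by nth_rw 2 [← hPf]; rw [← mul_assoc, hfP, hPf]
  have hfα : ∀ b, f * α' b = α' b * f := fun b =>
    hcomm _ (map_mul_dualIdempotent h hα b)
      (by rw [← map_star]; exact map_mul_dualIdempotent h hα (star b))
  have hf0 : f ≠ 0 := by
    rintro rfl
    exact dualIdempotent_ne_zero h hα hq0 (by rw [← hfP, zero_mul])
  obtain ⟨t', ht', rfl⟩ := h.symm.exists_isometry hN hff hf hfα hf0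
  exact (h.compress ht hα ht' hfα hfP hPf).hasFiniteDim hN hM

end Factors

/-! ### Modules and the associated element of the extension. -/

section Modules

/-- Each `b` is recovered from `ι'(b)` as `ι(w* ι'(b)) v`. Identities in the extension can thus be
checked after applying `ι'`. -/
theorem Extension.injective {A B : Type*} [Ring A] [StarRing A] [Algebra ℂ A]
    [Ring B] [StarRing B] [Algebra ℂ B] {Q : QSystem A} (E : Extension Q B) :
    Function.Injective E.ι' := by
  intro a b hab
  have h := E.standard.toIsConjugateSolution
  have key : ∀ b, b = E.ι (star Q.w * E.ι' b) * E.v := fun b => by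
    rw [map_mul, mul_assoc, ← h.right_mul, ← mul_assoc, h.map_star_left_mul, one_mul]
  rw [key a, key b, hab]

variable {A B : Type*} [Ring A] [StarRing A] [Algebra ℂ A] [Ring B] [StarRing B] [Algebra ℂ B]
  {Q : QSystem A}

namespace IsStandardModule

variable {β : A →⋆ₐ[ℂ] A} {m : A}

theorem mul_apply (hm : IsStandardModule Q β m) (a : A) : m * β a = Q.θ (β a) * m := hm.mem a

theorem star_w_mul (hm : IsStandardModule Q β m) : star Q.w * m = 1 := by
  simpa only [hprod, map_one, mul_one] using hm.unit

theorem map_mul_self (hm : IsStandardModule Q β m) : Q.θ m * m = Q.x * m := by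
  simpa only [hprod, map_one, mul_one, one_mul] using hm.repr

theorem star_mul_map_star (hm : IsStandardModule Q β m) :
    star m * Q.θ (star m) = star m * star Q.x := by
  simpa only [star_mul, ← map_star] using congrArg star hm.map_mul_self

end IsStandardModule

/-- The free module `(ι' φ, x)` defined by a homomorphism `φ` into the extension. -/
theorem Extension.isStandardModule (E : Extension Q B) (φ : A →⋆ₐ[ℂ] B)
    (hφ : HasFiniteDim (E.ι'.comp φ)) : IsStandardModule Q (E.ι'.comp φ) Q.x where
  finiteDim := hφ
  mem a := by
    have h := E.standard.toIsConjugateSolution.right_mul (φ a)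
    simp only [StarAlgHom.comp_apply, E.θ_eq, E.x_eq, ← map_mul, h]
  unit := Q.unit_left
  repr := Q.assoc.symm
  standard := ⟨_, Q.standard_x⟩

/-- The element `ι(m*) v` of the extension, which is up to a scalar a projection of `Hom(ιβ, ιβ)`
for a standard module `(β, m)`. -/
def Extension.moduleElement (E : Extension Q B) (m : A) : B := E.ι (star m) * E.v

variable (E : Extension Q B) {β : A →⋆ₐ[ℂ] A} {m : A}

theorem Extension.ι'_moduleElement : E.ι' (E.moduleElement m) = Q.θ (star m) * Q.x := by
  rw [Extension.moduleElement, map_mul, ← E.x_eq, E.θ_eq, StarAlgHom.comp_apply]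

theorem IsStandardModule.moduleElement_comm (hm : IsStandardModule Q β m) (a : A) :
    E.moduleElement m * E.ι (β a) = E.ι (β a) * E.moduleElement m := by
  have h := E.standard.toIsConjugateSolution
  have h1 : star m * Q.θ (β a) = β a * star m := by
    have := congrArg star (hm.mul_apply (star a))
    simpa only [star_mul, ← map_star, star_star] using this.symm
  rw [Extension.moduleElement, mul_assoc, h.right_mul, ← mul_assoc, ← map_mul, ← mul_assoc,
    ← map_mul, ← h1, E.θ_eq]
  rfl

/-- The right side is `ι'(e)` for `e = ι(m*) v`. Granted `e* = e`, the module law and the Frobenius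
relation identify it with `m m*`. -/
theorem IsStandardModule.mul_star_self (hm : IsStandardModule Q β m)
    (he : star (E.moduleElement m) = E.moduleElement m) :
    m * star m = Q.θ (star m) * Q.x := by
  have hwx : star Q.x * Q.w = 1 := by
    have := congrArg star Q.unit_left
    simpa only [hprod, map_one, mul_one, star_mul, star_star, star_one] using this
  have hxx : Q.θ (star Q.x) * Q.x = Q.x * star Q.x := by
    simpa only [hprod, map_one, mul_one, one_mul] using Q.frobenius_left
  have hw : ∀ a, Q.w * a = Q.θ a * Q.w := Q.w_mem
  have hx : ∀ a, Q.x * Q.θ a = Q.θ (Q.θ a) * Q.x := Q.x_mem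
  have he' : Q.θ (star m) * Q.x = star Q.x * Q.θ m := by
    rw [← E.ι'_moduleElement, ← he, map_star, E.ι'_moduleElement, star_mul, ← map_star, star_star]
  -- Self-adjointness enters here: `ι'(e) = x* θ(m)`, and `x* θ(m) w = x* w m = m`.
  have hm' : m = Q.θ (star m) * Q.x * Q.w := by
    rw [he', mul_assoc, ← hw, ← mul_assoc, hwx, one_mul]
  calc m * star m = Q.θ (star m) * (Q.x * (Q.w * star m)) := by
        nth_rw 1 [hm']; simp only [mul_assoc]
    _ = Q.θ (star m) * (Q.θ (Q.θ (star m)) * (Q.x * Q.w)) := by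
        rw [hw, ← mul_assoc Q.x, hx, mul_assoc]
    _ = Q.θ (star m * star Q.x) * (Q.x * Q.w) := by
        rw [← mul_assoc, ← map_mul, hm.star_mul_map_star]
    _ = Q.θ (star m) * (Q.x * (star Q.x * Q.w)) := by
        rw [map_mul, mul_assoc, ← mul_assoc (Q.θ _) Q.x, hxx, mul_assoc]
    _ = Q.θ (star m) * Q.x := by rw [hwx, mul_one]

end Modules

/-! ### The module element is a multiple of a projection. -/

section Factors

variable {H : Type*} [NormedAddCommGroup H] [InnerProductSpace ℂ H] [CompleteSpace H]
  {K : Type*} [NormedAddCommGroup K] [InnerProductSpace ℂ K] [CompleteSpace K]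
  {N : VonNeumannAlgebra H} {M : VonNeumannAlgebra K}
  {Q : QSystem N.Elt} {β : N.Elt →⋆ₐ[ℂ] N.Elt} {m : N.Elt}

theorem QSystem.sqrt_dim_ne_zero [Nontrivial N.Elt] (Q : QSystem N.Elt) : √(dim Q.θ) ≠ 0 := by
  intro h0
  have hw := Q.standard_w
  have hu := Q.unit_left
  rw [h0, Complex.ofReal_zero, map_zero] at hw
  rw [VonNeumannAlgebra.eq_zero_of_star_mul_self hw] at hu
  simp [hprod] at hu

/-- If `m* m = c`, the square of `θ(m) m = x m` is `c²` computed from the left side and `d c` from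
the right side, with `d = √(dim θ)`. The unit law excludes `c = 0`. -/
theorem IsStandardModule.star_mul_self [Nontrivial N.Elt] (hm : IsStandardModule Q β m) :
    star m * m = algebraMap ℂ N.Elt (√(dim Q.θ) : ℝ) := by
  obtain ⟨c, hc⟩ := hm.standard
  have hc0 : c ≠ 0 := by
    rintro rfl
    rw [map_zero] at hc
    have := hm.star_w_mul
    rw [VonNeumannAlgebra.eq_zero_of_star_mul_self hc, mul_zero] at this
    exact zero_ne_one this
  have h1 : star (Q.θ m * m) * (Q.θ m * m) = algebraMap ℂ N.Elt (c * c) := by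
    rw [star_mul, ← map_star, mul_assoc, ← mul_assoc (Q.θ _), ← map_mul, hc, AlgHomClass.commutes,
      Algebra.left_comm, hc, map_mul]
  have h2 : star (Q.θ m * m) * (Q.θ m * m) = algebraMap ℂ N.Elt ((√(dim Q.θ) : ℝ) * c) := by
    rw [hm.map_mul_self, star_mul, mul_assoc, ← mul_assoc (star Q.x), Q.standard_x,
      Algebra.left_comm, hc, map_mul]
  rw [hc, mul_right_cancel₀ hc0 ((algebraMap ℂ N.Elt).injective (h1.symm.trans h2))]

/-- Under `ι'` the square becomes `θ(m* θ(m*)) x x`. The module law and associativity turn it into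
`θ(m* x* x) x`, and `x* x` is the scalar. -/
theorem IsStandardModule.moduleElement_mul_self (hm : IsStandardModule Q β m)
    (E : Extension Q M.Elt) :
    E.moduleElement m * E.moduleElement m = ((√(dim Q.θ) : ℝ) : ℂ) • E.moduleElement m := by
  apply E.injective
  rw [map_mul, map_smul, E.ι'_moduleElement]
  have hx : ∀ a, Q.x * Q.θ a = Q.θ (Q.θ a) * Q.x := Q.x_mem
  have hass : Q.x * Q.x = Q.θ Q.x * Q.x := by
    simpa only [hprod, map_one, mul_one, one_mul] using Q.assoc
  calc Q.θ (star m) * Q.x * (Q.θ (star m) * Q.x)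
      = Q.θ (star m) * (Q.x * Q.θ (star m)) * Q.x := by simp only [mul_assoc]
    _ = Q.θ (star m * Q.θ (star m)) * (Q.x * Q.x) := by rw [hx, map_mul]; simp only [mul_assoc]
    _ = Q.θ (star m * (star Q.x * Q.x)) * Q.x := by
      rw [hm.star_mul_map_star, hass]; simp only [map_mul, mul_assoc]
    _ = _ := by rw [Q.standard_x, ← Algebra.commutes, ← Algebra.smul_def, map_smul,
      smul_mul_assoc]

/-- The element `ι(m*) v` is self-adjoint, for a standard module `(β, m)`. -/
theorem IsStandardModule.star_moduleElement [Nontrivial N.Elt] (hm : IsStandardModule Q β m)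
    (E : Extension Q M.Elt) : star (E.moduleElement m) = E.moduleElement m := by
  set d : ℝ := √(dim Q.θ) with hd
  have hd0 : d ≠ 0 := Q.sqrt_dim_ne_zero
  have hdpos : 0 < d := lt_of_le_of_ne (Real.sqrt_nonneg _) hd0.symm
  have hdc : (d : ℂ) ≠ 0 := Complex.ofReal_ne_zero.2 hd0
  set e := E.moduleElement m with he
  -- Read off from `x = ι'(v)` and `x* x = d`, so that `dim ι` need not be compared with `√(dim θ)`.
  have hv : star E.v * E.v = (d : ℂ) • (1 : M.Elt) := by
    apply E.injective
    rw [map_mul, map_star, ← E.x_eq, Q.standard_x, map_smul, map_one, Algebra.algebraMap_eq_smul_one]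
  have hm1 : star m * m = (d : ℂ) • (1 : N.Elt) := by
    rw [hm.star_mul_self, Algebra.algebraMap_eq_smul_one]
  have hee : e * e = (d : ℂ) • e := hm.moduleElement_mul_self E
  set g : M.Elt := (d : ℂ)⁻¹ • (E.v * star E.v) with hg
  have hg' : star g = g := by simp [hg]
  have hgg : g * g = g := by
    rw [hg, smul_mul_smul_comm, mul_assoc, ← mul_assoc (star E.v), hv, smul_mul_assoc, one_mul,
      mul_smul_comm, smul_smul, mul_assoc, inv_mul_cancel₀ hdc, mul_one]
  have hr : ((√d⁻¹ : ℝ) : ℂ) * ((√d⁻¹ : ℝ) : ℂ) = (d : ℂ)⁻¹ := by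
    rw [← Complex.ofReal_mul, Real.mul_self_sqrt (by positivity), Complex.ofReal_inv]
  have hp : ((d : ℂ)⁻¹ • e) * ((d : ℂ)⁻¹ • e) = (d : ℂ)⁻¹ • e := by
    rw [smul_mul_smul_comm, hee, smul_smul, mul_assoc, inv_mul_cancel₀ hdc, mul_one]
  -- Contractivity of `d⁻¹ e`: as `e e* = d ι(m*) g ι(m)` and `m* m = d`, the defect comes from the
  -- complementary projection `1 - g`.
  have hy : 1 - ((d : ℂ)⁻¹ • e) * star ((d : ℂ)⁻¹ • e)
      = star (((√d⁻¹ : ℝ) : ℂ) • ((1 - g) * E.ι m)) * (((√d⁻¹ : ℝ) : ℂ) • ((1 - g) * E.ι m)) := by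
    have h1 : star ((1 - g) * E.ι m) * ((1 - g) * E.ι m)
        = (d : ℂ) • (1 : M.Elt) - (d : ℂ)⁻¹ • (e * star e) := by
      have h2 : (1 - g) * (1 - g) = 1 - g := by
        simp only [mul_sub, sub_mul, mul_one, one_mul, hgg]; abel
      have h3 : E.ι (star m) * E.ι m = (d : ℂ) • (1 : M.Elt) := by
        rw [← map_mul, hm1, map_smul, map_one]
      calc star ((1 - g) * E.ι m) * ((1 - g) * E.ι m)
          = E.ι (star m) * ((1 - g) * (1 - g)) * E.ι m := by
            rw [star_mul, star_sub, star_one, hg', map_star]; simp only [mul_assoc]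
        _ = E.ι (star m) * E.ι m - E.ι (star m) * g * E.ι m := by
            rw [h2, mul_sub, sub_mul, mul_one]
        _ = _ := by
            rw [h3, hg, he, Extension.moduleElement, star_mul, ← map_star, star_star]
            simp only [mul_smul_comm, smul_mul_assoc, mul_assoc]
    rw [star_smul, star_smul, smul_mul_smul_comm, smul_mul_smul_comm, h1, smul_sub, smul_smul,
      smul_smul]
    have hs1 : star ((d : ℂ)⁻¹) = (d : ℂ)⁻¹ := by simp
    have hs2 : star ((√d⁻¹ : ℝ) : ℂ) = ((√d⁻¹ : ℝ) : ℂ) := by simp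
    rw [hs1, hs2, hr, inv_mul_cancel₀ hdc, one_smul]
  have hps := VonNeumannAlgebra.star_eq_of_contractive_idempotent hp hy
  rw [star_smul, show star ((d : ℂ)⁻¹) = (d : ℂ)⁻¹ by simp] at hps
  exact smul_right_injective _ (inv_ne_zero hdc) hps

end Factors

end QSys
end

/-! ### The homomorphism `φ` and the unitary equivalence. -/

set_option maxHeartbeats 1000000 in
/-- The Q-system `Q` is simple when the von Neumann algebra `M` of its extension is a factor. -/
theorem mainTheorem3
    {H : Type*} [NormedAddCommGroup H] [InnerProductSpace ℂ H] [CompleteSpace H]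
    [TopologicalSpace.SeparableSpace H]
    {K : Type*} [NormedAddCommGroup K] [InnerProductSpace ℂ K] [CompleteSpace K]
    (N : VonNeumannAlgebra H) (hN : N.IsFactor) (hN_inf : N.IsInfinite)
    (Q : QSys.QSystem N.Elt)
    (M : VonNeumannAlgebra K) (E : QSys.Extension Q M.Elt) (hM : M.IsFactor)
    (β : N.Elt →⋆ₐ[ℂ] N.Elt) (m : N.Elt) (hm : QSys.IsStandardModule Q β m) :
    ∃ φ : N.Elt →⋆ₐ[ℂ] M.Elt,
      QSys.HasFiniteDim φ ∧
      QSys.IsStandardModule Q (E.ι'.comp φ)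
        (QSys.hprod E.ι' 1 (QSys.hprod (StarAlgHom.id ℂ M.Elt) E.v 1)) ∧
      QSys.UnitarilyEquivalent Q β m (E.ι'.comp φ)
        (QSys.hprod E.ι' 1 (QSys.hprod (StarAlgHom.id ℂ M.Elt) E.v 1)) := by
  have : Nontrivial N.Elt := by
    obtain ⟨s, -, hs⟩ := hN_inf
    exact ⟨⟨_, _, hs⟩⟩
  have : Nontrivial M.Elt := ⟨⟨1, 0, fun h => by
    have := congrArg E.ι' h
    rw [map_one, map_zero] at this
    exact one_ne_zero this⟩⟩
  have hx : QSys.hprod E.ι' 1 (QSys.hprod (StarAlgHom.id ℂ M.Elt) E.v 1) = Q.x := by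
    simp only [QSys.hprod, map_one, mul_one, one_mul, E.x_eq]
  rw [hx]
  obtain ⟨β', r, r', _, hr⟩ := hm.finiteDim
  have hβ := hr.toIsConjugateSolution
  have hιβ := E.standard.toIsConjugateSolution.comp hβ
  set d : ℝ := √(QSys.dim Q.θ) with hd
  have hd0 : d ≠ 0 := Q.sqrt_dim_ne_zero
  have hdpos : 0 < d := lt_of_le_of_ne (Real.sqrt_nonneg _) hd0.symm
  have hdc : (d : ℂ) ≠ 0 := Complex.ofReal_ne_zero.2 hd0
  have hm1 : star m * m = (d : ℂ) • (1 : N.Elt) := by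
    rw [hm.star_mul_self, Algebra.algebraMap_eq_smul_one]
  set e := E.moduleElement m with he
  have hes : star e = e := hm.star_moduleElement E
  have hee : e * e = (d : ℂ) • e := hm.moduleElement_mul_self E
  have hemm : E.ι' e = m * star m := by
    rw [hm.mul_star_self E hes, E.ι'_moduleElement]
  have hm0 : m ≠ 0 := by
    rintro rfl
    simpa using hm.star_w_mul
  have hmm : m * star m * m = (d : ℂ) • m := by rw [mul_assoc, hm1, mul_smul_comm, mul_one]
  -- The projection `d⁻¹ e` is nonzero because `ι'(e) m = m m* m = d m`.
  obtain ⟨s, hs, hss⟩ := hιβ.exists_isometry hM (q := (d : ℂ)⁻¹ • e)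
    (by rw [smul_mul_smul_comm, hee, smul_smul, mul_assoc, inv_mul_cancel₀ hdc, mul_one])
    (by rw [star_smul, hes]; simp)
    (fun a => by
      rw [smul_mul_assoc, mul_smul_comm]
      exact congrArg _ (hm.moduleElement_comm E a))
    (fun h0 => by
      have h1 : e = 0 := (smul_eq_zero.1 h0).resolve_left (inv_ne_zero hdc)
      rw [← hemm, h1, map_zero, zero_mul] at hmm
      exact (smul_ne_zero hdc hm0) hmm.symm)
  have hsm : E.ι' (s * star s) * m = m := by
    rw [hss, map_smul, hemm, smul_mul_assoc, hmm, smul_smul, inv_mul_cancel₀ hdc, one_smul]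
  have hscomm : ∀ a, s * star s * E.ι.comp β a = E.ι.comp β a * (s * star s) := fun a => by
    rw [hss, smul_mul_assoc, mul_smul_comm]
    exact congrArg _ (hm.moduleElement_comm E a)
  set φ := QSys.compress (E.ι.comp β) s hs hscomm with hφ
  -- Since `ι'(s s*) m = m` and `m* m = d`, the factor `d^(-1/2)` makes `ι'(s*) m` an isometry; it
  -- is unitary because `m m* = d ι'(s s*)`.
  set c : ℂ := ((√d⁻¹ : ℝ) : ℂ) with hc
  have hcs : star c = c := by simp [hc]
  have hcc : c * c = (d : ℂ)⁻¹ := by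
    rw [← Complex.ofReal_mul, Real.mul_self_sqrt (by positivity), Complex.ofReal_inv]
  set u : N.Elt := c • (E.ι' (star s) * m) with hu
  have hu1 : star u * u = 1 := by
    rw [hu, star_smul, hcs, smul_mul_smul_comm, hcc, star_mul, ← map_star, star_star, mul_assoc,
      ← mul_assoc (E.ι' s), ← map_mul, hsm, hm1, smul_smul, inv_mul_cancel₀ hdc, one_smul]
  have hu2 : u * star u = 1 := by
    have h1 : m * star m = (d : ℂ) • E.ι' (s * star s) := by
      rw [hss, map_smul, smul_smul, mul_inv_cancel₀ hdc, one_smul, hemm]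
    rw [hu, star_smul, hcs, smul_mul_smul_comm, hcc, star_mul, ← map_star, star_star, mul_assoc,
      ← mul_assoc m, h1, smul_mul_assoc, mul_smul_comm, smul_smul, inv_mul_cancel₀ hdc, one_smul,
      ← map_mul, ← map_mul, mul_assoc, hs, mul_one, hs, map_one]
  have hint : ∀ a, u * β a = E.ι' (φ a) * u := fun a => by
    have h1 : φ a * star s = star s * E.ι (β a) := QSys.compress_mul_star a
    have h2 : Q.θ (β a) = E.ι' (E.ι (β a)) := by rw [E.θ_eq]; rfl
    rw [hu, smul_mul_assoc, mul_smul_comm, mul_assoc, hm.mul_apply, h2, ← mul_assoc, ← mul_assoc,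
      ← map_mul, ← map_mul, h1]
  -- `ι'φ = u β(·) u*` is the compression of `β` by the unitary `u*`, so it inherits a conjugate
  -- from `β`.
  have hfin : QSys.HasFiniteDim (E.ι'.comp φ) := by
    have ht : star (star u) * star u = 1 := by rw [star_star, hu2]
    have htβ : ∀ a, star u * star (star u) * β a = β a * (star u * star (star u)) := fun a => by
      rw [star_star, hu1, one_mul, mul_one]
    have heq : E.ι'.comp φ = QSys.compress β (star u) ht htβ := by
      ext1 a
      rw [QSys.compress_apply, star_star, hint, mul_assoc, hu2, mul_one]
      rfl
    rw [heq]
    exact hβ.hasFiniteDim_compress hN hN ht htβ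
  refine ⟨φ, hιβ.hasFiniteDim_compress hN hM hs hscomm, E.isStandardModule φ hfin,
    u, ⟨hu1, hu2⟩, hint, ?_⟩
  -- The image under `ι'` of `v s* = ι(ι'(s*)) v`. Together with `θ(m) m = x m` it makes `u` a
  -- module map.
  have h1 : Q.θ (E.ι' (star s)) * Q.x = Q.x * E.ι' (star s) := by
    rw [E.x_eq, E.θ_eq, StarAlgHom.comp_apply, ← map_mul, ← map_mul,
      E.standard.toIsConjugateSolution.right_mul]
  rw [QSys.hprod, one_mul, hu, map_smul, mul_smul_comm, smul_mul_assoc, map_mul, mul_assoc,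
    hm.map_mul_self, ← mul_assoc, ← mul_assoc, h1]
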